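/- For real $a,b$ and an integer $n\ge 0$ let $$P^{(a,b)}_n(x)=\sum_{k=0}^{n}\frac{(n+a+b+1)_k\,(a+k+1)_{n-k}}{k!\,(n-k)!}\Big(\frac{x-1}{2}\Big)^k,\qquad (c)_k=c(c+1)\cdots(c+k-1),$$ be the Jacobi polynomial, and set $\xi_{\alpha,\beta,m}=P^{(-\alpha,\beta)}_m$. Let $m\ge 1$ be an integer and let $\alpha,\beta>-1$ be real numbers such that $\beta\neq 0$ and $$\alpha\notin\{0,1,\ldots,m-1\},\qquad \alpha-\beta-m+1\notin\{0,1,\ldots,m-1\}.$$ Then the polynomial $\xi_{\alpha+1,\beta-1,m}=P^{(-\alpha-1,\beta-1)}_m$ has no zeros in $(-1,1)$ if and only if $$\alpha>m-2\quad\text{and}\quad \operatorname{sgn}(\alpha-m+1)=\operatorname{sgn}(\beta).$$ Moreover, the same condition holds if and only if the $X_m$ Jacobi weight $$\widehat W_{\alpha,\beta,m}(x)=\frac{(1-x)^\alpha(1+x)^\beta}{\xi_{\alpha+1,\beta-1,m}(x)^2}$$ is non-singular on $(-1,1)$, that is, defined, continuous and positive at every point of $(-1,1)$. -/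

import Mathlib

noncomputable section

/-- The Jacobi polynomial `P_n^{(a,b)}`, for arbitrary real parameters, by its classical explicit
formula: the sum over `0 ≤ k ≤ n` of
`(n+a+b+1)_k (a+k+1)_{n-k} / (k! (n-k)!) * ((x-1)/2)^k`,
where `(c)_k = c (c+1) ⋯ (c+k-1)`. In particular its value at `1` is `binom (n+a) n`. -/
def jacobiPoly (a b : ℝ) (n : ℕ) : Polynomial ℝ :=
  ∑ k ∈ Finset.range (n + 1),
    Polynomial.C ((ascPochhammer ℝ k).eval ((n : ℝ) + a + b + 1) *
        (ascPochhammer ℝ (n - k)).eval (a + k + 1) / ((k.factorial : ℝ) * (n - k).factorial)) *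
      (Polynomial.C (1 / 2) * (Polynomial.X - 1)) ^ k

/-- `ξ_{α,β,m} = P_m^{(-α,β)}`. -/
def xiPoly (α β : ℝ) (m : ℕ) : Polynomial ℝ := jacobiPoly (-α) β m

/-- The weight of the `X_m` Jacobi polynomials,
`(1-x)^α (1+x)^β / ξ_{α+1,β-1,m}(x)^2`, considered for `-1 < x < 1`. -/
def exceptionalJacobiWeight (α β : ℝ) (m : ℕ) (x : ℝ) : ℝ :=
  (1 - x) ^ α * (1 + x) ^ β / ((xiPoly (α + 1) (β - 1) m).eval x) ^ 2

/-- A weight is non-singular on `(-1,1)` if it is continuous and positive there. (At a zero of its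
denominator the weight above blows up, so it is not continuous there, whatever its value.) -/
def IsNonsingularWeight (W : ℝ → ℝ) : Prop :=
  ContinuousOn W (Set.Ioo (-1) 1) ∧ ∀ x ∈ Set.Ioo (-1 : ℝ) 1, 0 < W x

end

open Polynomial Finset

namespace JacobiPolynomial

/-! Put `a = -α - 1`, `b = β - 1`. In powers of `(x - 1) / 2` and `(x + 1) / 2`, the polynomial has
explicit product coefficients (`jacobiPoly_eq_sum_symmCoeff`). Under the stated condition all its
terms have the same sign on `(-1, 1)`, so there is no zero. Otherwise there is a zero. If `β < 0`
and `α > m - 1`, the endpoint values have opposite signs. In the other cases Rolle's theorem,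
applied to the weighted polynomial with raised parameters (`exists_root_between`), produces zeros;
each step trades one degree for one unit of `a`, keeping `a` plus the degree fixed. -/

theorem ascPochhammer_eval_succ_left (x : ℝ) (k : ℕ) :
    (ascPochhammer ℝ (k + 1)).eval x = x * (ascPochhammer ℝ k).eval (x + 1) := by
  simp [ascPochhammer_succ_left, eval_comp]

theorem neg_one_pow_mul_ascPochhammer_eval_pos (k : ℕ) (x : ℝ) (hx : x + k < 1) :
    0 < (-1) ^ k * (ascPochhammer ℝ k).eval x := by
  induction k with
  | zero => simp
  | succ k ih =>
    push_cast at hx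
    rw [ascPochhammer_succ_eval]
    have h := mul_pos (ih (by linarith)) (by linarith : 0 < -(x + k))
    calc (0 : ℝ) < _ := h
      _ = _ := by ring

/-! ### The raising operator -/

/-- The polynomial `(X - 1) / 2`. -/
noncomputable abbrev halfSub : ℝ[X] := C (1 / 2) * (X - 1)

/-- The first order operator `(X ^ 2 - 1) / 2 * d/dX + ((a + 1) (X + 1) + (b + 1) (X - 1)) / 2`,
which raises the degree of Jacobi polynomials and lowers their parameters. -/
noncomputable def raise (a b : ℝ) (f : ℝ[X]) : ℝ[X] :=
  2 * halfSub * (1 + halfSub) * derivative f +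
    (C (a + 1) * (1 + halfSub) + C (b + 1) * halfSub) * f

theorem raise_sum (a b : ℝ) {ι : Type*} (s : Finset ι) (f : ι → ℝ[X]) :
    raise a b (∑ i ∈ s, f i) = ∑ i ∈ s, raise a b (f i) := by
  simp [raise, mul_sum, sum_add_distrib]

/-- With `T = halfSub`, the first-order term of the operator is `T (1 + T) d/dT`, which multiplies a
monomial in `T` and `1 + T` by `s (1 + T) + r T`. -/
theorem raise_C_mul_pow_mul_pow (a b c : ℝ) (s r : ℕ) :
    raise a b (C c * (halfSub ^ s * (1 + halfSub) ^ r)) =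
      C (c * (s + a + 1)) * (halfSub ^ s * (1 + halfSub) ^ (r + 1)) +
        C (c * (r + b + 1)) * (halfSub ^ (s + 1) * (1 + halfSub) ^ r) := by
  have hT : derivative halfSub = C (1 / 2) := by simp [halfSub]
  have h2 : (2 : ℝ[X]) * C (1 / 2) = 1 := by
    rw [← C_ofNat, ← C_mul]; norm_num
  have hs : halfSub * derivative (halfSub ^ s) = C (1 / 2) * C (s : ℝ) * halfSub ^ s := by
    cases s with
    | zero => simp
    | succ s => rw [derivative_pow, hT, Nat.add_sub_cancel]; ring
  have hr : (1 + halfSub) * derivative ((1 + halfSub) ^ r) =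
      C (1 / 2) * C (r : ℝ) * (1 + halfSub) ^ r := by
    cases r with
    | zero => simp
    | succ r =>
      rw [derivative_pow, derivative_add, hT, derivative_one, zero_add, Nat.add_sub_cancel]; ring
  rw [raise, derivative_C_mul, derivative_mul]
  generalize halfSub = T at *
  simp only [C_mul, C_add, C_1] at *
  linear_combination 2 * C c * (1 + T) ^ (r + 1) * hs + 2 * C c * T ^ (s + 1) * hr +
    (C c * C (s : ℝ) * T ^ s * (1 + T) ^ (r + 1) +
      C c * C (r : ℝ) * T ^ (s + 1) * (1 + T) ^ r) * h2

theorem sum_two_term {M : Type*} [AddCommMonoid M] (n : ℕ) (A B D : ℕ → M)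
    (h₀ : A 0 = D 0) (hn : B n = D (n + 1)) (h : ∀ k < n, A (k + 1) + B k = D (k + 1)) :
    ∑ k ∈ range (n + 1), (A k + B k) = ∑ k ∈ range (n + 2), D k := by
  rw [sum_add_distrib, sum_range_succ' A, sum_range_succ B, sum_range_succ' D, sum_range_succ,
    ← sum_congr rfl fun k hk => h k (mem_range.mp hk), sum_add_distrib, h₀, hn]
  abel

theorem jacobiPoly_succ (a b : ℝ) (n : ℕ) :
    C ((n : ℝ) + 1) * jacobiPoly a b (n + 1) = raise a b (jacobiPoly (a + 1) (b + 1) n) := by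
  have hterm (c : ℝ) (k : ℕ) : raise a b (C c * halfSub ^ k) =
      C (c * (k + a + 1)) * halfSub ^ k + C (c * (k + a + b + 2)) * halfSub ^ (k + 1) := by
    have h := raise_C_mul_pow_mul_pow a b c k 0
    simp only [pow_zero, mul_one, Nat.cast_zero] at h
    rw [h]
    simp only [C_mul, C_add, C_1, C_0, C_ofNat]
    ring
  rw [jacobiPoly, jacobiPoly, raise_sum, mul_sum]
  simp only [hterm]
  symm
  apply sum_two_term
  · simp only [pow_zero, mul_one, ← C_mul]
    congr 1
    simp only [Nat.sub_zero, ascPochhammer_zero, eval_one,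
      Nat.factorial_zero, Nat.factorial_succ, ascPochhammer_eval_succ_left]
    push_cast
    have := Nat.factorial_ne_zero n
    field_simp
    ring_nf
  · rw [← mul_assoc, ← C_mul]
    congr 2
    simp only [Nat.sub_self, ascPochhammer_zero, eval_one, Nat.factorial_zero,
      ascPochhammer_eval_succ_left, Nat.factorial_succ]
    push_cast
    have := Nat.factorial_ne_zero n
    field_simp
    ring_nf
  · intro k hk
    obtain ⟨r, rfl⟩ := Nat.exists_eq_add_of_lt hk
    rw [← mul_assoc, ← C_mul, ← add_mul, ← C_add]
    congr 2
    rw [show k + r + 1 - (k + 1) = r by omega, show k + r + 1 - k = r + 1 by omega,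
      show k + r + 1 + 1 - (k + 1) = r + 1 by omega]
    have e1 : ((k + r + 1 : ℕ) : ℝ) + (a + 1) + (b + 1) + 1 =
      (((k + r + 1 + 1 : ℕ) : ℝ) + a + b + 1) + 1 := by push_cast; ring
    have e2 : a + 1 + ((k + 1 : ℕ) : ℝ) + 1 = a + ((k + 1 : ℕ) : ℝ) + 1 + 1 := by ring
    have e3 : a + 1 + (k : ℝ) + 1 = a + ((k + 1 : ℕ) : ℝ) + 1 := by push_cast; ring
    rw [e1, e2, e3, ascPochhammer_succ_eval k (_ + 1), ascPochhammer_eval_succ_left _ k,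
      ascPochhammer_eval_succ_left _ r, Nat.factorial_succ k, Nat.factorial_succ r]
    have := Nat.factorial_ne_zero k
    have := Nat.factorial_ne_zero r
    push_cast
    field_simp
    ring

/-! ### Expansion symmetric in the two endpoints -/

/-- The coefficients of the Jacobi polynomial in powers of `(X - 1) / 2` and `(X + 1) / 2`. -/
noncomputable def symmCoeff (a b : ℝ) (s r : ℕ) : ℝ :=
  (ascPochhammer ℝ r).eval (a + s + 1) * (ascPochhammer ℝ s).eval (b + r + 1) /
    (s.factorial * r.factorial)

theorem symmCoeff_shift_right (a b : ℝ) (s r : ℕ) :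
    symmCoeff (a + 1) (b + 1) s r * (s + a + 1) = (r + 1) * symmCoeff a b s (r + 1) := by
  rw [symmCoeff, symmCoeff, ascPochhammer_eval_succ_left, Nat.factorial_succ,
    show a + 1 + s + 1 = a + s + 1 + 1 by ring,
    show b + 1 + (r : ℝ) + 1 = b + (r + 1 : ℕ) + 1 by push_cast; ring]
  have := Nat.factorial_ne_zero s
  have := Nat.factorial_ne_zero r
  push_cast
  field_simp
  ring

theorem symmCoeff_shift_left (a b : ℝ) (s r : ℕ) :
    symmCoeff (a + 1) (b + 1) s r * (r + b + 1) = (s + 1) * symmCoeff a b (s + 1) r := by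
  rw [symmCoeff, symmCoeff, ascPochhammer_eval_succ_left, Nat.factorial_succ,
    show b + 1 + r + 1 = b + r + 1 + 1 by ring,
    show a + 1 + (s : ℝ) + 1 = a + (s + 1 : ℕ) + 1 by push_cast; ring]
  have := Nat.factorial_ne_zero s
  have := Nat.factorial_ne_zero r
  push_cast
  field_simp
  ring

/-- Both sides satisfy the recursion of `jacobiPoly_succ` and agree in degree `0`. -/
theorem jacobiPoly_eq_sum_symmCoeff (a b : ℝ) (n : ℕ) :
    jacobiPoly a b n = ∑ s ∈ range (n + 1),
      C (symmCoeff a b s (n - s)) * (halfSub ^ s * (1 + halfSub) ^ (n - s)) := by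
  induction n generalizing a b with
  | zero => simp [jacobiPoly, symmCoeff]
  | succ n ih =>
    have hn : C ((n : ℝ) + 1) ≠ 0 := by
      rw [Ne, C_eq_zero]; positivity
    apply mul_left_cancel₀ hn
    rw [jacobiPoly_succ, ih, raise_sum, mul_sum]
    simp only [raise_C_mul_pow_mul_pow, symmCoeff_shift_right, symmCoeff_shift_left]
    apply sum_two_term
    · simp [mul_assoc]
    · simp [mul_assoc]
    · intro k hk
      obtain ⟨r, rfl⟩ := Nat.exists_eq_add_of_lt hk
      rw [show k + r + 1 - (k + 1) = r by omega, show k + r + 1 - k = r + 1 by omega,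
        show k + r + 1 + 1 - (k + 1) = r + 1 by omega, ← mul_assoc (C _) (C _), ← C_mul,
        ← add_mul, ← C_add]
      congr 2
      push_cast
      ring

theorem jacobiPoly_eval (a b : ℝ) (n : ℕ) (x : ℝ) :
    (jacobiPoly a b n).eval x = ∑ s ∈ range (n + 1),
      symmCoeff a b s (n - s) * (((x - 1) / 2) ^ s * ((1 + x) / 2) ^ (n - s)) := by
  rw [jacobiPoly_eq_sum_symmCoeff, eval_finsetSum]
  refine sum_congr rfl fun s _ => ?_
  simp only [eval_mul, eval_C, eval_pow, eval_add, eval_one, eval_sub, eval_X]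
  ring

theorem jacobiPoly_eval_one (a b : ℝ) (n : ℕ) :
    (jacobiPoly a b n).eval 1 = (ascPochhammer ℝ n).eval (a + 1) / n.factorial := by
  rw [jacobiPoly_eval, sum_range_succ']
  simp [symmCoeff]

theorem jacobiPoly_eval_neg_one (a b : ℝ) (n : ℕ) :
    (jacobiPoly a b n).eval (-1) =
      (-1) ^ n * (ascPochhammer ℝ n).eval (b + 1) / n.factorial := by
  rw [jacobiPoly_eval, sum_range_succ, sum_eq_zero fun s hs => ?_]
  · norm_num [symmCoeff]
    ring
  · have : n - s ≠ 0 := by have := mem_range.mp hs; omega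
    simp [this]

/-! ### Absence of zeros -/

theorem jacobiPoly_eval_ne_zero_of_symmCoeff (a b ε : ℝ) (n : ℕ)
    (h : ∀ s ≤ n, 0 < ε * (-1) ^ s * symmCoeff a b s (n - s)) {x : ℝ}
    (hx : x ∈ Set.Ioo (-1 : ℝ) 1) : (jacobiPoly a b n).eval x ≠ 0 := by
  have hpos : 0 < ε * (jacobiPoly a b n).eval x := by
    rw [jacobiPoly_eval, mul_sum]
    refine sum_pos (fun s hs => ?_) ⟨0, by simp⟩
    have h1 : 0 < (1 - x) / 2 := by linarith [hx.2]
    have h2 : 0 < (1 + x) / 2 := by linarith [hx.1]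
    have h3 := mul_pos (h s (by have := mem_range.mp hs; omega))
      (mul_pos (pow_pos h1 s) (pow_pos h2 (n - s)))
    rw [show (x - 1) / 2 = (-1) * ((1 - x) / 2) by ring, mul_pow]
    calc (0 : ℝ) < _ := h3
      _ = _ := by ring
  exact right_ne_zero_of_mul hpos.ne'

/-- The `n - s` factors involving `a` are negative and those involving `b` positive; with the sign
of `(x - 1) ^ s`, every term has sign `(-1) ^ n`. -/
theorem jacobiPoly_eval_ne_zero_of_lt_neg {a b : ℝ} {n : ℕ} (ha : a < -n) (hb : -1 < b) {x : ℝ}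
    (hx : x ∈ Set.Ioo (-1 : ℝ) 1) : (jacobiPoly a b n).eval x ≠ 0 := by
  refine jacobiPoly_eval_ne_zero_of_symmCoeff a b ((-1) ^ n) n (fun s hs => ?_) hx
  obtain ⟨r, rfl⟩ := Nat.exists_eq_add_of_le hs
  rw [Nat.add_sub_cancel_left, symmCoeff]
  push_cast at ha
  have h1 := neg_one_pow_mul_ascPochhammer_eval_pos r (a + s + 1) (by linarith)
  have h2 := ascPochhammer_pos s (b + r + 1) (by have := r.cast_nonneg (α := ℝ); linarith)
  have h3 : (0 : ℝ) < s.factorial * r.factorial := by positivity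
  calc (0 : ℝ) < _ := div_pos (mul_pos h1 h2) h3
    _ = ((-1) ^ s * (-1) ^ s) * (((-1) ^ r * (ascPochhammer ℝ r).eval (a + s + 1)) *
          (ascPochhammer ℝ s).eval (b + r + 1) / (s.factorial * r.factorial)) := by
        rw [← mul_pow]; norm_num
    _ = _ := by ring

theorem jacobiPoly_eval_ne_zero_of_mem_Ioo {a b : ℝ} {n : ℕ} (ha : -((n : ℝ) + 1) < a)
    (ha' : a < -n) (hb : -2 < b) (hb' : b < -1) {x : ℝ}
    (hx : x ∈ Set.Ioo (-1 : ℝ) 1) : (jacobiPoly a b (n + 1)).eval x ≠ 0 := by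
  refine jacobiPoly_eval_ne_zero_of_symmCoeff a b ((-1) ^ n) (n + 1) (fun s hs => ?_) hx
  have hmm (k : ℕ) : ((-1 : ℝ) ^ k * (-1) ^ k) = 1 := by rw [← mul_pow]; norm_num
  -- For `s ≤ n` only the last factor involving `a`, namely `a + n + 1`, is positive. For `s = n +
  -- 1` no such factor remains, and `b + 1` supplies the compensating sign.
  rcases hs.lt_or_eq with hs | rfl
  · obtain ⟨r, rfl⟩ := Nat.exists_eq_add_of_le (Nat.lt_succ_iff.mp hs)
    rw [show s + r + 1 - s = r + 1 by omega, symmCoeff, ascPochhammer_succ_eval]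
    push_cast at ha ha' ⊢
    have h0 : 0 < a + s + 1 + r := by linarith
    have h1 := neg_one_pow_mul_ascPochhammer_eval_pos r (a + s + 1) (by linarith)
    have h2 := ascPochhammer_pos s (b + (r + 1) + 1)
      (by have := r.cast_nonneg (α := ℝ); linarith)
    have h3 : (0 : ℝ) < s.factorial * (r + 1).factorial := by positivity
    calc (0 : ℝ) < _ := div_pos (mul_pos (mul_pos h1 h0) h2) h3
      _ = ((-1) ^ s * (-1) ^ s) * (((-1) ^ r * (ascPochhammer ℝ r).eval (a + s + 1)) *
            (a + s + 1 + r) * (ascPochhammer ℝ s).eval (b + (r + 1) + 1) /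
              (s.factorial * (r + 1).factorial)) := by rw [hmm, one_mul]
      _ = _ := by ring
  · rw [Nat.sub_self, symmCoeff, ascPochhammer_eval_succ_left]
    have h1 : 0 < -(b + 1) := by linarith
    have h2 := ascPochhammer_pos n (b + 1 + 1) (by linarith)
    have h3 : (0 : ℝ) < (n + 1).factorial := by positivity
    calc (0 : ℝ) < _ := div_pos (mul_pos h1 h2) h3
      _ = ((-1) ^ n * (-1) ^ n) * (-(b + 1) * (ascPochhammer ℝ n).eval (b + 1 + 1) /
            (n + 1).factorial) := by rw [hmm, one_mul]
      _ = _ := by simp [pow_succ]; ring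

/-! ### Existence of zeros -/

/-- Rolle's theorem for `(1 - x) ^ (a + 1) * (1 + x) ^ (b + 1) * P_n^{(a + 1, b + 1)}(x)`. -/
theorem exists_root_between {a b u v : ℝ} {n : ℕ} (huv : u < v)
    (hu : u = -1 ∧ -1 < b ∨ -1 < u ∧ (jacobiPoly (a + 1) (b + 1) n).eval u = 0)
    (hv : v = 1 ∧ -1 < a ∨ v < 1 ∧ (jacobiPoly (a + 1) (b + 1) n).eval v = 0) :
    ∃ x ∈ Set.Ioo u v, (jacobiPoly a b (n + 1)).eval x = 0 := by
  set Q := jacobiPoly (a + 1) (b + 1) n with hQ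
  set f : ℝ → ℝ := fun x => (1 - x) ^ (a + 1) * (1 + x) ^ (b + 1) * Q.eval x with hf
  have hu1 : -1 ≤ u := by rcases hu with h | h <;> linarith [h.1]
  have hv1 : v ≤ 1 := by rcases hv with h | h <;> linarith [h.1]
  have hcont : ContinuousOn f (Set.Icc u v) := by
    refine ((ContinuousOn.rpow_const (by fun_prop) fun x hx => ?_).mul
      (ContinuousOn.rpow_const (by fun_prop) fun x hx => ?_)).mul Q.continuous.continuousOn
    · rcases hv with h | h
      · right; linarith [h.2]
      · left; linarith [h.1, hx.2]
    · rcases hu with h | h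
      · right; linarith [h.2]
      · left; linarith [h.1, hx.1]
  have hfu : f u = 0 := by
    rcases hu with ⟨rfl, h⟩ | h
    · simp [hf, Real.zero_rpow (by linarith : b + 1 ≠ 0)]
    · simp [hf, h.2]
  have hfv : f v = 0 := by
    rcases hv with ⟨rfl, h⟩ | h
    · simp [hf, Real.zero_rpow (by linarith : a + 1 ≠ 0)]
    · simp [hf, h.2]
  have hderiv (x : ℝ) (hx : x ∈ Set.Ioo u v) : HasDerivAt f
      (-2 * (n + 1) * ((1 - x) ^ a * (1 + x) ^ b) * (jacobiPoly a b (n + 1)).eval x) x := by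
    have h1 : 0 < 1 - x := by linarith [hx.2]
    have h2 : 0 < 1 + x := by linarith [hx.1]
    have d1 := ((hasDerivAt_id x).const_sub 1).rpow_const (p := a + 1) (Or.inl h1.ne')
    have d2 := ((hasDerivAt_id x).const_add 1).rpow_const (p := b + 1) (Or.inl h2.ne')
    refine ((d1.mul d2).mul (Q.hasDerivAt x)).congr_deriv ?_
    have key := congrArg (eval x) (jacobiPoly_succ a b n)
    rw [← hQ] at key
    simp only [raise, eval_mul, eval_C, eval_add, eval_one, eval_sub, eval_X, eval_ofNat] at key
    simp only [id, add_sub_cancel_right, Pi.mul_apply, Real.rpow_add_one h1.ne',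
      Real.rpow_add_one h2.ne']
    linear_combination (-2) * ((1 - x) ^ a * (1 + x) ^ b) * (-key)
  obtain ⟨x, hx, h⟩ := exists_hasDerivAt_eq_zero huv hcont (hfu.trans hfv.symm) hderiv
  refine ⟨x, hx, ?_⟩
  have h1 := Real.rpow_pos_of_pos (by linarith [hx.2] : 0 < 1 - x) a
  have h2 := Real.rpow_pos_of_pos (by linarith [hx.1] : 0 < 1 + x) b
  refine (mul_eq_zero.mp h).resolve_left (mul_ne_zero (mul_ne_zero (by norm_num) ?_) ?_)
  · positivity
  · positivity

theorem exists_root {a b : ℝ} {n : ℕ} (hb : -1 < b) (han : 0 < a + (n + 1)) :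
    ∃ x ∈ Set.Ioo (-1 : ℝ) 1, (jacobiPoly a b (n + 1)).eval x = 0 := by
  induction n generalizing a b with
  | zero =>
    simp only [Nat.cast_zero] at han
    exact exists_root_between (by norm_num) (Or.inl ⟨rfl, hb⟩) (Or.inl ⟨rfl, by linarith⟩)
  | succ n ih =>
    push_cast at han
    obtain ⟨z, hz, hz0⟩ := ih (a := a + 1) (b := b + 1) (by linarith) (by linarith)
    obtain ⟨x, hx, hx0⟩ :=
      exists_root_between hz.1 (Or.inl ⟨rfl, hb⟩) (Or.inr ⟨hz.2, hz0⟩)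
    exact ⟨x, ⟨hx.1, hx.2.trans hz.2⟩, hx0⟩

theorem exists_two_roots {a b : ℝ} {n : ℕ} (hb : -1 < b) (han : 1 < a + (n + 2)) :
    ∃ x y : ℝ, -1 < x ∧ x < y ∧ y < 1 ∧ (jacobiPoly a b (n + 2)).eval x = 0 ∧
      (jacobiPoly a b (n + 2)).eval y = 0 := by
  induction n generalizing a b with
  | zero =>
    simp only [Nat.cast_zero] at han
    obtain ⟨z, hz, hz0⟩ := exists_root (a := a + 1) (b := b + 1) (n := 0) (by linarith)
      (by simp only [Nat.cast_zero]; linarith)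
    obtain ⟨x, hx, hx0⟩ :=
      exists_root_between hz.1 (Or.inl ⟨rfl, hb⟩) (Or.inr ⟨hz.2, hz0⟩)
    obtain ⟨y, hy, hy0⟩ :=
      exists_root_between hz.2 (Or.inr ⟨hz.1, hz0⟩) (Or.inl ⟨rfl, by linarith⟩)
    exact ⟨x, y, hx.1, hx.2.trans hy.1, hy.2, hx0, hy0⟩
  | succ n ih =>
    push_cast at han
    obtain ⟨z, w, hz, hzw, hw, hz0, hw0⟩ :=
      ih (a := a + 1) (b := b + 1) (by linarith) (by linarith)
    obtain ⟨x, hx, hx0⟩ :=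
      exists_root_between hz (Or.inl ⟨rfl, hb⟩) (Or.inr ⟨hzw.trans hw, hz0⟩)
    obtain ⟨y, hy, hy0⟩ :=
      exists_root_between hzw (Or.inr ⟨hz, hz0⟩) (Or.inr ⟨hw, hw0⟩)
    exact ⟨x, y, hx.1, hx.2.trans hy.1, hy.2.trans hw, hx0, hy0⟩

/-- The weight need not vanish at `-1`, so Rolle needs another pair of points: a zero and the
endpoint `1` if `a > -1`, two zeros otherwise. -/
theorem exists_root_of_neg_two_lt {a b : ℝ} {n : ℕ} (hb : -2 < b) (han : 1 < a + (n + 2)) :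
    ∃ x ∈ Set.Ioo (-1 : ℝ) 1, (jacobiPoly a b (n + 2)).eval x = 0 := by
  rcases lt_or_ge (-1) a with ha | ha
  · obtain ⟨z, hz, hz0⟩ := exists_root (a := a + 1) (b := b + 1) (n := n) (by linarith)
      (by linarith)
    obtain ⟨x, hx, hx0⟩ :=
      exists_root_between hz.2 (Or.inr ⟨hz.1, hz0⟩) (Or.inl ⟨rfl, ha⟩)
    exact ⟨x, ⟨hz.1.trans hx.1, hx.2⟩, hx0⟩
  · obtain _ | n := n
    · simp only [Nat.cast_zero] at han
      linarith
    · push_cast at han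
      obtain ⟨z, w, hz, hzw, hw, hz0, hw0⟩ := exists_two_roots (a := a + 1) (b := b + 1) (n := n)
        (by linarith) (by linarith)
      obtain ⟨x, hx, hx0⟩ :=
        exists_root_between hzw (Or.inr ⟨hz, hz0⟩) (Or.inr ⟨hw, hw0⟩)
      exact ⟨x, ⟨hz.trans hx.1, hx.2.trans hw⟩, hx0⟩

theorem exists_root_of_eval_mul_eval_neg (p : ℝ[X]) (h : p.eval (-1) * p.eval 1 < 0) :
    ∃ x ∈ Set.Ioo (-1 : ℝ) 1, p.eval x = 0 := by
  have hc : ContinuousOn (fun x => p.eval x) (Set.Icc (-1) 1) := p.continuous.continuousOn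
  rcases mul_neg_iff.mp h with h | h
  · exact intermediate_value_Ioo' (by norm_num) hc ⟨h.2, h.1⟩
  · exact intermediate_value_Ioo (by norm_num) hc ⟨h.1, h.2⟩

theorem exists_root_of_lt_neg {a b : ℝ} {n : ℕ} (ha : a < -(n + 1)) (hb : -2 < b)
    (hb' : b < -1) : ∃ x ∈ Set.Ioo (-1 : ℝ) 1, (jacobiPoly a b (n + 1)).eval x = 0 := by
  apply exists_root_of_eval_mul_eval_neg
  have h1 := neg_one_pow_mul_ascPochhammer_eval_pos (n + 1) (a + 1) (by push_cast; linarith)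
  have h2 := mul_pos (by linarith : 0 < -(b + 1))
    (ascPochhammer_pos n (b + 1 + 1) (by linarith))
  have h3 : (0 : ℝ) < (n + 1).factorial := by positivity
  rw [jacobiPoly_eval_one, jacobiPoly_eval_neg_one, ascPochhammer_eval_succ_left (b + 1),
    ← neg_pos]
  calc (0 : ℝ) < _ := mul_pos (div_pos h1 h3) (div_pos h2 h3)
    _ = _ := by ring

/-! ### Zeros and singularities of the weight -/

/-- A quotient of a positive continuous function by the square of a nonzero polynomial is
continuous only if the polynomial has no zero. -/
theorem eval_ne_zero_of_continuousOn_div {p : ℝ[X]} (hp : p ≠ 0) {g : ℝ → ℝ} {s : Set ℝ}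
    (hs : IsOpen s) (hg : ContinuousOn g s) (hpos : ∀ x ∈ s, 0 < g x)
    (h : ContinuousOn (fun x => g x / p.eval x ^ 2) s) {x : ℝ} (hx : x ∈ s) : p.eval x ≠ 0 := by
  intro h0
  have hmem := hs.mem_nhds hx
  -- The product tends to `0` by continuity, yet it equals `g` near `x` off `x`. The point `x` is
  -- removed because division by zero there returns `0`.
  have h1 : Filter.Tendsto (fun y => g y / p.eval y ^ 2 * p.eval y ^ 2) (nhdsWithin x {x}ᶜ)
      (nhds (g x / p.eval x ^ 2 * p.eval x ^ 2)) :=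
    ((h.continuousAt hmem).mul (p.continuous.continuousAt.pow 2)).tendsto.mono_left
      nhdsWithin_le_nhds
  have h2 : Filter.Tendsto g (nhdsWithin x {x}ᶜ) (nhds (g x)) :=
    (hg.continuousAt hmem).tendsto.mono_left nhdsWithin_le_nhds
  have hroots : ∀ᶠ y in nhdsWithin x {x}ᶜ, p.eval y ≠ 0 := by
    have hfin : (p.rootSet ℝ \ {x}).Finite := (p.rootSet_finite ℝ).subset Set.sdiff_subset
    have hev : ∀ᶠ y in nhds x, y ∉ p.rootSet ℝ \ {x} :=
      hfin.isClosed.isOpen_compl.mem_nhds (by simp)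
    filter_upwards [nhdsWithin_le_nhds hev, self_mem_nhdsWithin] with y hy hyx hy0
    exact hy ⟨(mem_rootSet.mpr ⟨hp, by simpa using hy0⟩), hyx⟩
  have h3 := h1.congr' (hroots.mono fun y hy => div_mul_cancel₀ _ (pow_ne_zero 2 hy))
  have h4 := tendsto_nhds_unique h2 h3
  rw [h0] at h4
  simp only [ne_eq, OfNat.ofNat_ne_zero, not_false_eq_true, zero_pow, mul_zero] at h4
  exact (hpos x hx).ne' h4

theorem isNonsingularWeight_iff {α β : ℝ} {m : ℕ} (hα : ∀ k : ℕ, k < m → α ≠ k) :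
    IsNonsingularWeight (exceptionalJacobiWeight α β m) ↔
      ∀ x ∈ Set.Ioo (-1 : ℝ) 1, (xiPoly (α + 1) (β - 1) m).eval x ≠ 0 := by
  have hg : ContinuousOn (fun x : ℝ => (1 - x) ^ α * (1 + x) ^ β) (Set.Ioo (-1) 1) :=
    (ContinuousOn.rpow_const (by fun_prop) fun x hx => Or.inl (by linarith [hx.2])).mul
      (ContinuousOn.rpow_const (by fun_prop) fun x hx => Or.inl (by linarith [hx.1]))
  have hpos : ∀ x ∈ Set.Ioo (-1 : ℝ) 1, 0 < (1 - x) ^ α * (1 + x) ^ β := fun x hx =>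
    mul_pos (Real.rpow_pos_of_pos (by linarith [hx.2]) _)
      (Real.rpow_pos_of_pos (by linarith [hx.1]) _)
  constructor
  · rintro ⟨hc, -⟩ x hx
    refine eval_ne_zero_of_continuousOn_div (fun h0 => ?_) isOpen_Ioo hg hpos hc hx
    -- The value at `1` is `(-α)_m / m!`, nonzero by the condition on `α`.
    have h1 := jacobiPoly_eval_one (-(α + 1)) (β - 1) m
    rw [show jacobiPoly (-(α + 1)) (β - 1) m = 0 from h0, eval_zero, eq_comm, div_eq_zero_iff,
      or_iff_left (by positivity), ascPochhammer_eval_eq_zero_iff] at h1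
    obtain ⟨k, hk, h⟩ := h1
    exact hα k hk (by linarith)
  · intro h
    exact ⟨hg.div (by fun_prop) fun x hx => pow_ne_zero 2 (h x hx),
      fun x hx => div_pos (hpos x hx) (sq_pos_of_ne_zero (h x hx))⟩

end JacobiPolynomial

/-! ### The criterion -/

theorem xiPoly_eval_ne_zero_iff (m : ℕ) (hm : 1 ≤ m) (α β : ℝ) (hα : -1 < α) (hβ : -1 < β)
    (hβ0 : β ≠ 0) (hα_nondeg : ∀ k : ℕ, k < m → α ≠ k) :
    (∀ x ∈ Set.Ioo (-1 : ℝ) 1, (xiPoly (α + 1) (β - 1) m).eval x ≠ 0) ↔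
      ((m : ℝ) - 2 < α ∧ SignType.sign (α - m + 1) = SignType.sign β) := by
  obtain ⟨n, rfl⟩ := Nat.exists_eq_add_of_le' hm
  have hαn := hα_nondeg n (by omega)
  unfold xiPoly
  push_cast
  constructor
  · intro h
    have hlt : (n : ℝ) + 1 - 2 < α := by
      by_contra hle
      obtain _ | n := n
      · norm_num at hle; linarith
      -- This excludes `α = m - 2`, giving the strict inequality that the root lemma needs.
      · have hαn' := hα_nondeg n (by omega)
        push_cast at hle
        have : α < n := lt_of_le_of_ne (by linarith) hαn'
        obtain ⟨x, hx, hx0⟩ := JacobiPolynomial.exists_root_of_neg_two_lt (a := -(α + 1))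
          (b := β - 1) (n := n) (by linarith) (by linarith)
        exact h x hx hx0
    refine ⟨hlt, ?_⟩
    rcases lt_or_gt_of_ne hαn with h1 | h1 <;> rcases lt_or_gt_of_ne hβ0 with h2 | h2
    · rw [sign_neg h2, sign_neg (by linarith)]
    · obtain ⟨x, hx, hx0⟩ := JacobiPolynomial.exists_root (a := -(α + 1))
        (b := β - 1) (n := n) (by linarith) (by linarith)
      exact absurd hx0 (h x hx)
    · obtain ⟨x, hx, hx0⟩ := JacobiPolynomial.exists_root_of_lt_neg (a := -(α + 1))
        (b := β - 1) (n := n) (by linarith) (by linarith) (by linarith)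
      exact absurd hx0 (h x hx)
    · rw [sign_pos h2, sign_pos (by linarith)]
  · rintro ⟨hlt, hsgn⟩ x hx
    rcases lt_or_gt_of_ne hβ0 with h2 | h2
    · rw [sign_neg h2, sign_eq_neg_one_iff] at hsgn
      exact JacobiPolynomial.jacobiPoly_eval_ne_zero_of_mem_Ioo (by linarith) (by linarith)
        (by linarith) (by linarith) hx
    · rw [sign_pos h2, sign_eq_one_iff] at hsgn
      exact JacobiPolynomial.jacobiPoly_eval_ne_zero_of_lt_neg (by push_cast; linarith)
        (by linarith) hx

theorem proposition4p5 (m : ℕ) (hm : 1 ≤ m) (α β : ℝ) (hα : -1 < α) (hβ : -1 < β)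
    (hβ0 : β ≠ 0)
    (hα_nondeg : ∀ k : ℕ, k < m → α ≠ k)
    (hαβ_nondeg : ∀ k : ℕ, k < m → α - β - m + 1 ≠ k) :
    ((∀ x ∈ Set.Ioo (-1 : ℝ) 1, (xiPoly (α + 1) (β - 1) m).eval x ≠ 0) ↔
      ((m : ℝ) - 2 < α ∧ SignType.sign (α - m + 1) = SignType.sign β)) ∧
    (IsNonsingularWeight (exceptionalJacobiWeight α β m) ↔
      ((m : ℝ) - 2 < α ∧ SignType.sign (α - m + 1) = SignType.sign β)) := by
  have h := xiPoly_eval_ne_zero_iff m hm α β hα hβ hβ0 hα_nondeg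
  exact ⟨h, (JacobiPolynomial.isNonsingularWeight_iff hα_nondeg).trans h⟩
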